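/- Let $\mathcal M=(S,A,P,\mu_0,\gamma)$ be a finite reward-free discounted MDP: $S,A$ finite, $P(\cdot\mid s,a)$ and $\mu_0$ probability distributions on $S$, $\gamma\in[0,1)$. Let $$\Phi=\Bigl\{d\in\mathbb R_{\ge 0}^{S\times A}:\ \sum_a d(s',a)-\gamma\sum_{s,a}P(s'\mid s,a)\,d(s,a)=(1-\gamma)\mu_0(s')\ \ \forall s'\in S\Bigr\}$$ be the polytope of occupancy measures, and for a reward $r$ in the probability simplex $\Delta(S\times A)$ and $d\in\Phi$ let $\mathrm{subopt}(r,d)=\max_{\tilde d\in\Phi}r^\top(\tilde d-d)$. For $d_e^\star\in\Phi$ let $\mathcal R(d_e^\star)$ be the set of $r\in\Delta(S\times A)$ for which $d_e^\star$ maximizes $r^\top d$ over $d\in\Phi$. For a finite dataset $\mathcal D=\{(d_e^k,\epsilon^k)\}_{k=1}^K$ with $d_e^k\in\Phi$ and $\epsilon^k\ge 0$ let $$\mathcal R(\mathcal D)=\{r\in\Delta(S\times A):\ \mathrm{subopt}(r,d_e^k)\le\epsilon^k\ \ \forall k\},\qquad \mathrm{Gap}(\mathcal R(\mathcal D),\mathcal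 R(d_e^\star))=\max_{r\in\mathcal R(\mathcal D)}\mathrm{subopt}(r,d_e^\star).$$ For nonempty $X,Y\subset\mathbb R^{S\times A}$ let $d_H(X\mid Y)=\sup_{x\in X}\inf_{y\in Y}\|x-y\|_\infty$. **Proposition.** (i) For every $\mathcal M$ and every $d_e^\star\in\Phi$ there is a constant $C>0$, depending only on $\mathcal M$ and $d_e^\star$ (not on the dataset), such that for every dataset $\mathcal D$ $$d_H\bigl(\mathcal R(\mathcal D)\mid\mathcal R(d_e^\star)\bigr)\le C\,\mathrm{Gap}\bigl(\mathcal R(\mathcal D),\mathcal R(d_e^\star)\bigr).$$ (ii) There is a constant $C>0$ depending only on $\mathcal M$ for which this inequality holds for all datasets $\mathcal D$ and simultaneously for all $d_e^\star$ that are vertices (extreme points) of $\Phi$. (iii) In particular, for every $d_e^\star\in\Phi$, whenever datasets vary along a sequence (or, more generally, any filter) such that $\mathrm{Gap}(\mathcal R(\mathcal D),\mathcal R(d_e^\star))\to0$, also $d_H(\mathcal R(\mathcal D)\mid\mathcal R(d_e^\star))\to0$. -/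

import Mathlib

open Filter Topology

/-- A finite discounted Markov decision process without reward: transition kernel `P s a`,
initial distribution `μ₀` and discount factor `γ ∈ [0, 1)`. -/
structure RewardFreeMDP (S A : Type*) [Fintype S] where
  P : S → A → S → ℝ
  P_mem : ∀ s a, P s a ∈ stdSimplex ℝ S
  μ₀ : S → ℝ
  μ₀_mem : μ₀ ∈ stdSimplex ℝ S
  γ : ℝ
  γ_nonneg : 0 ≤ γ
  γ_lt_one : γ < 1

/-- The one-sided Hausdorff distance `sup_{x ∈ X} inf_{y ∈ Y} ‖x - y‖`; the norm on `ι → ℝ`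
is the sup norm. -/
noncomputable def oneSidedHausdorffDist {ι : Type*} [Fintype ι] (X Y : Set (ι → ℝ)) : ℝ :=
  ⨆ x : X, ⨅ y : Y, ‖(x : ι → ℝ) - (y : ι → ℝ)‖

namespace RewardFreeMDP

section

variable {S A : Type*} [Fintype S] [Fintype A]

/-- The Bellman flow operator
`d ↦ (s' ↦ ∑ a, d (s', a) - γ ∑ (s, a), P (s' | s, a) d (s, a))`. -/
def flow (M : RewardFreeMDP S A) (d : S × A → ℝ) : S → ℝ :=
  fun s' => ∑ a, d (s', a) - M.γ * ∑ z : S × A, M.P z.1 z.2 s' * d z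

/-- The polytope of (normalized, discounted) occupancy measures. -/
def occupancySet (M : RewardFreeMDP S A) : Set (S × A → ℝ) :=
  {d | 0 ≤ d ∧ M.flow d = (1 - M.γ) • M.μ₀}

/-- The occupancy measures that are optimal under the reward `r`. -/
def optimalOccupancies (M : RewardFreeMDP S A) (r : S × A → ℝ) : Set (S × A → ℝ) :=
  {d | d ∈ M.occupancySet ∧ ∀ d' ∈ M.occupancySet, r ⬝ᵥ d' ≤ r ⬝ᵥ d}

/-- `subopt r d = max_{d' ∈ Φ} rᵀ (d' - d)`. -/
noncomputable def subopt (M : RewardFreeMDP S A) (r d : S × A → ℝ) : ℝ :=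
  ⨆ d' : M.occupancySet, r ⬝ᵥ ((d' : S × A → ℝ) - d)

/-- The rewards in the probability simplex under which the occupancy measure `d` is optimal. -/
def rewardSet (M : RewardFreeMDP S A) (d : S × A → ℝ) : Set (S × A → ℝ) :=
  {r | r ∈ stdSimplex ℝ (S × A) ∧ d ∈ M.optimalOccupancies r}

/-- Finitely many demonstrations: occupancy measures `d k` with declared suboptimality
levels `ε k ≥ 0`. -/
structure Dataset (M : RewardFreeMDP S A) where
  K : ℕ
  d : Fin K → S × A → ℝ
  ε : Fin K → ℝ
  d_mem : ∀ k, d k ∈ M.occupancySet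
  ε_nonneg : ∀ k, 0 ≤ ε k

/-- The rewards in the probability simplex under which each demonstration `d k` is at most
`ε k`-suboptimal. -/
def feasibleRewardSet (M : RewardFreeMDP S A) (D : M.Dataset) : Set (S × A → ℝ) :=
  {r | r ∈ stdSimplex ℝ (S × A) ∧ ∀ k, M.subopt r (D.d k) ≤ D.ε k}

/-- The maximum suboptimality of the occupancy measure `dstar` over the rewards in `R`. -/
noncomputable def gap (M : RewardFreeMDP S A) (R : Set (S × A → ℝ)) (dstar : S × A → ℝ) : ℝ :=
  ⨆ r : R, M.subopt r dstar

/-! Well-definedness: occupancy measures have unit mass, the suprema above are over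
bounded sets, and the reward sets are nonempty. -/

theorem sum_eq_one (M : RewardFreeMDP S A) {d : S × A → ℝ} (hd : d ∈ M.occupancySet) :
    ∑ z, d z = 1 := by
  have h := congrArg (fun f : S → ℝ => ∑ s, f s) hd.2
  simp only [flow, Finset.sum_sub_distrib, Pi.smul_apply, smul_eq_mul, ← Finset.mul_sum] at h
  rw [M.μ₀_mem.2, Finset.sum_comm, ← Fintype.sum_prod_type'] at h
  have h2 : ∑ z : S × A, ∑ s', M.P z.1 z.2 s' * d z = ∑ z, d z := by
    refine Finset.sum_congr rfl fun z _ => ?_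
    rw [← Finset.sum_mul, (M.P_mem z.1 z.2).2, one_mul]
  have h3 : ∑ x : A × S, d (x.2, x.1) = ∑ z, d z :=
    Fintype.sum_equiv (Equiv.prodComm A S) _ _ fun _ => rfl
  have h4 : ∑ y, ∑ x, M.P x.1 x.2 y * d x = ∑ z, d z := by
    rw [Finset.sum_comm]; exact h2
  rw [h4] at h
  have h5 : (1 - M.γ) * (∑ z, d z) = (1 - M.γ) * 1 := by
    linarith [h, h3]
  exact mul_left_cancel₀ (by linarith [M.γ_lt_one]) h5

theorem occupancySet_subset_stdSimplex (M : RewardFreeMDP S A) :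
    M.occupancySet ⊆ stdSimplex ℝ (S × A) :=
  fun _ hd => ⟨fun z => hd.1 z, M.sum_eq_one hd⟩

theorem dotProduct_le_one {r d : S × A → ℝ} (hr : r ∈ stdSimplex ℝ (S × A))
    (hd : d ∈ stdSimplex ℝ (S × A)) : r ⬝ᵥ d ≤ 1 := by
  rw [← hd.2]
  refine Finset.sum_le_sum fun z _ => ?_
  have : r z ≤ 1 := by
    rw [← hr.2]; exact Finset.single_le_sum (fun i _ => hr.1 i) (Finset.mem_univ z)
  exact mul_le_of_le_one_left (hd.1 z) this

theorem dotProduct_nonneg' {r d : S × A → ℝ} (hr : r ∈ stdSimplex ℝ (S × A))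
    (hd : d ∈ stdSimplex ℝ (S × A)) : 0 ≤ r ⬝ᵥ d :=
  Finset.sum_nonneg fun z _ => mul_nonneg (hr.1 z) (hd.1 z)

theorem bddAbove_subopt (M : RewardFreeMDP S A) {r d : S × A → ℝ}
    (hr : r ∈ stdSimplex ℝ (S × A)) :
    BddAbove (Set.range fun d' : M.occupancySet => r ⬝ᵥ ((d' : S × A → ℝ) - d)) := by
  refine ⟨1 - r ⬝ᵥ d, ?_⟩
  rintro _ ⟨d', rfl⟩
  have := dotProduct_le_one hr (M.occupancySet_subset_stdSimplex d'.2)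
  simp only [dotProduct_sub]
  linarith

theorem bddAbove_gap (M : RewardFreeMDP S A) {R : Set (S × A → ℝ)} {dstar : S × A → ℝ}
    (hR : R ⊆ stdSimplex ℝ (S × A)) (hd : dstar ∈ M.occupancySet) :
    BddAbove (Set.range fun r : R => M.subopt r dstar) := by
  refine ⟨1, ?_⟩
  rintro _ ⟨r, rfl⟩
  have : Nonempty M.occupancySet := ⟨⟨dstar, hd⟩⟩
  refine ciSup_le fun d' => ?_
  have h1 := dotProduct_le_one (hR r.2) (M.occupancySet_subset_stdSimplex d'.2)
  have h2 := dotProduct_nonneg' (hR r.2) (M.occupancySet_subset_stdSimplex hd)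
  rw [dotProduct_sub]
  linarith

/-- For an occupancy measure `d`, optimality of `d` means zero suboptimality. -/
theorem mem_rewardSet_iff (M : RewardFreeMDP S A) {r d : S × A → ℝ}
    (hd : d ∈ M.occupancySet) :
    r ∈ M.rewardSet d ↔ r ∈ stdSimplex ℝ (S × A) ∧ M.subopt r d ≤ 0 := by
  have : Nonempty M.occupancySet := ⟨⟨d, hd⟩⟩
  refine and_congr_right fun hr => ⟨fun h => ?_, fun h => ⟨hd, fun d' hd' => ?_⟩⟩
  · refine ciSup_le fun d' => ?_
    rw [dotProduct_sub]
    linarith [h.2 d' d'.2]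
  · have := (le_ciSup (M.bddAbove_subopt (d := d) hr) ⟨d', hd'⟩).trans h
    simp only [dotProduct_sub] at this
    linarith

/-- The uniform reward makes every occupancy measure optimal. -/
theorem exists_mem_rewardSet (M : RewardFreeMDP S A) (h : M.occupancySet.Nonempty) :
    ∃ r, ∀ d ∈ M.occupancySet, r ∈ M.rewardSet d := by
  obtain ⟨d₀, h₀⟩ := h
  have : Nonempty (S × A) := by
    by_contra hne
    rw [not_nonempty_iff] at hne
    simpa using M.sum_eq_one h₀
  have key : ∀ d ∈ M.occupancySet,
      (fun _ : S × A => (Fintype.card (S × A) : ℝ)⁻¹) ⬝ᵥ d = (Fintype.card (S × A) : ℝ)⁻¹ := by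
    intro d hd
    simp only [dotProduct, ← Finset.mul_sum, M.sum_eq_one hd, mul_one]
  refine ⟨fun _ => (Fintype.card (S × A) : ℝ)⁻¹, fun d hd =>
    ⟨⟨fun _ => by positivity, ?_⟩, hd, fun d' hd' => ?_⟩⟩
  · rw [Finset.sum_const, Finset.card_univ, nsmul_eq_mul, mul_inv_cancel₀]
    exact_mod_cast Fintype.card_ne_zero
  · rw [key d hd, key d' hd']

theorem feasibleRewardSet_nonempty (M : RewardFreeMDP S A) (h : M.occupancySet.Nonempty)
    (D : M.Dataset) : (M.feasibleRewardSet D).Nonempty := by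
  obtain ⟨r, hr⟩ := M.exists_mem_rewardSet h
  obtain ⟨d₀, h₀⟩ := h
  exact ⟨r, (hr d₀ h₀).1, fun k =>
    (((M.mem_rewardSet_iff (D.d_mem k)).1 (hr _ (D.d_mem k))).2).trans (D.ε_nonneg k)⟩

end

end RewardFreeMDP

/-! ### Polytopes: finitely many vertices, and a Hoffman-type error bound -/

section Polyhedral

variable {E : Type*} [NormedAddCommGroup E] [NormedSpace ℝ E]

/-! On the simplex, `subopt r d` is controlled by finitely many functionals `r ↦ r ⬝ᵥ (v - d)`, with
`v` a vertex of the occupancy polytope, and `rewardSet d` is where all of them are nonpositive. A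
Hoffman bound (`IsPolyhedral.exists_error_bound`) therefore makes the distance from `r` to
`rewardSet d` at most `C * subopt r d`. A dataset enters only through a subset of the simplex, so
`C` depends on the MDP and `d` alone; as the polytope has finitely many vertices, a maximum gives
one constant for all vertices.

The Hoffman bound itself comes from vertices: the truncated epigraph of the violation is a polytope,
the bound is trivial at each of its vertices, and it passes to convex combinations. -/

/-- A finite intersection of closed half-spaces. -/
def IsPolyhedral (s : Set E) : Prop :=
  ∃ F : Set ((E →ₗ[ℝ] ℝ) × ℝ), F.Finite ∧ s = {x | ∀ p ∈ F, p.1 x ≤ p.2}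

theorem isPolyhedral_halfSpace (f : E →ₗ[ℝ] ℝ) (b : ℝ) : IsPolyhedral {x | f x ≤ b} :=
  ⟨{(f, b)}, Set.finite_singleton _, by simp⟩

theorem IsPolyhedral.inter {s t : Set E} (hs : IsPolyhedral s) (ht : IsPolyhedral t) :
    IsPolyhedral (s ∩ t) := by
  obtain ⟨F, hF, rfl⟩ := hs
  obtain ⟨G, hG, rfl⟩ := ht
  refine ⟨F ∪ G, hF.union hG, ?_⟩
  ext x
  simp only [Set.mem_inter_iff, Set.mem_ofPred_eq, Set.mem_union, or_imp, forall_and]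

theorem isPolyhedral_hyperplane (f : E →ₗ[ℝ] ℝ) (b : ℝ) : IsPolyhedral {x | f x = b} := by
  have h := (isPolyhedral_halfSpace f b).inter (isPolyhedral_halfSpace (-f) (-b))
  convert h using 1
  ext x
  simp [le_antisymm_iff]

theorem IsPolyhedral.iInter {ι : Type*} [Finite ι] {s : ι → Set E}
    (h : ∀ i, IsPolyhedral (s i)) : IsPolyhedral (⋂ i, s i) := by
  choose F hF hs using h
  refine ⟨⋃ i, F i, Set.finite_iUnion hF, ?_⟩
  ext x
  simp only [hs, Set.mem_iInter, Set.mem_ofPred_eq, Set.mem_iUnion]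
  exact ⟨fun h p ⟨i, hi⟩ => h i p hi, fun h i p hp => h p ⟨i, hp⟩⟩

theorem IsPolyhedral.preimage {E' : Type*} [NormedAddCommGroup E'] [NormedSpace ℝ E']
    {s : Set E} (hs : IsPolyhedral s) (f : E' →ₗ[ℝ] E) : IsPolyhedral (f ⁻¹' s) := by
  obtain ⟨F, hF, rfl⟩ := hs
  refine ⟨(fun p => (p.1 ∘ₗ f, p.2)) '' F, hF.image _, ?_⟩
  ext x
  simp only [Set.mem_preimage, Set.mem_ofPred_eq, Set.forall_mem_image, LinearMap.comp_apply]

theorem IsPolyhedral.convex {s : Set E} (hs : IsPolyhedral s) : Convex ℝ s := by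
  obtain ⟨F, -, rfl⟩ := hs
  rw [show {x | ∀ p ∈ F, p.1 x ≤ p.2} = ⋂ p ∈ F, {x | p.1 x ≤ p.2} by ext; simp]
  exact convex_iInter₂ fun p _ => convex_halfSpace_le p.1.isLinear p.2

theorem IsPolyhedral.isClosed [FiniteDimensional ℝ E] {s : Set E} (hs : IsPolyhedral s) :
    IsClosed s := by
  obtain ⟨F, -, rfl⟩ := hs
  rw [show {x | ∀ p ∈ F, p.1 x ≤ p.2} = ⋂ p ∈ F, {x | p.1 x ≤ p.2} by ext; simp]
  exact isClosed_biInter fun p _ =>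
    isClosed_le p.1.continuous_of_finiteDimensional continuous_const

/-- An extreme point of a polyhedral set is determined by its active constraints. -/
theorem IsPolyhedral.finite_extremePoints {s : Set E} (hs : IsPolyhedral s) :
    (s.extremePoints ℝ).Finite := by
  obtain ⟨F, hF, rfl⟩ := hs
  refine Set.Finite.of_finite_image (f := fun x => {p ∈ F | p.1 x = p.2})
    (hF.finite_subsets.subset ?_) ?_
  · rintro _ ⟨x, -, rfl⟩
    exact Set.sep_subset _ _
  intro x hx y hy hxy
  obtain ⟨hxs, hext⟩ := hx
  have hact : ∀ p ∈ F, p.1 x = p.2 → p.1 y = p.2 := fun p hp h =>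
    ((Set.ext_iff.1 hxy p).1 ⟨hp, h⟩).2
  -- A small step from `x` away from `y` stays in the set: slack constraints survive by continuity,
  -- and constraints tight at `x` are tight at `y`, hence constant along the line. So `x` lies
  -- strictly inside a segment starting at `y`, forcing `x = y`.
  have hstep : ∀ᶠ δ in 𝓝[>] (0 : ℝ), ∀ p ∈ F, p.1 (x + δ • (x - y)) ≤ p.2 := by
    rw [Filter.eventually_all_finite hF]
    intro p hp
    rcases (hxs p hp).lt_or_eq with hlt | heq
    · have hc : Tendsto (fun δ : ℝ => p.1 x + δ * (p.1 x - p.1 y)) (𝓝[>] 0) (𝓝 (p.1 x)) := by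
        have : Continuous fun δ : ℝ => p.1 x + δ * (p.1 x - p.1 y) := by fun_prop
        simpa using (this.tendsto 0).mono_left nhdsWithin_le_nhds
      filter_upwards [hc.eventually_lt_const hlt] with δ hδ
      simpa using hδ.le
    · refine Eventually.of_forall fun δ => ?_
      simp [heq, hact p hp heq]
  obtain ⟨δ, hδ, hδ0⟩ := (hstep.and self_mem_nhdsWithin).exists
  have hδ0 : 0 < δ := hδ0
  have hseg : x ∈ openSegment ℝ y (x + δ • (x - y)) := by
    refine ⟨δ / (1 + δ), 1 / (1 + δ), by positivity, by positivity, by field_simp; ring, ?_⟩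
    rw [smul_add, smul_smul, smul_sub]
    match_scalars
    · field_simp
      ring
    · field_simp
  exact (hext hy.1 hδ hseg).symm

/-- Krein–Milman without the closure: the hull of finitely many points is already closed. -/
theorem IsPolyhedral.convexHull_extremePoints [FiniteDimensional ℝ E] {s : Set E}
    (hs : IsPolyhedral s) (hc : IsCompact s) : convexHull ℝ (s.extremePoints ℝ) = s := by
  rw [← (hs.finite_extremePoints.isClosed_convexHull ℝ).closure_eq,
    closure_convexHull_extremePoints hc hs.convex]

/-- A Hoffman error bound on a polytope. -/
theorem IsPolyhedral.exists_error_bound [FiniteDimensional ℝ E] {K : Set E}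
    (hK : IsPolyhedral K) (hc : IsCompact K) {G : Set (E →ₗ[ℝ] ℝ)} (hG : G.Finite)
    (hne : ∃ x ∈ K, ∀ f ∈ G, f x ≤ 0) :
    ∃ C : ℝ, 0 < C ∧ ∀ x ∈ K, ∀ t : ℝ, 0 ≤ t → t ≤ 1 → (∀ f ∈ G, f x ≤ t) →
      ∃ y ∈ K, (∀ f ∈ G, f y ≤ 0) ∧ ‖x - y‖ ≤ C * t := by
  obtain ⟨x₀, hx₀, hx₀G⟩ := hne
  have : Finite G := hG
  -- Epigraph of the violation `max f x` over `K`, cut at heights 0 and 1; the upper cut makes it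
  -- compact.
  set T : Set (E × ℝ) :=
    (LinearMap.fst ℝ E ℝ ⁻¹' K ∩ ⋂ f : G, {p | (f.1 ∘ₗ LinearMap.fst ℝ E ℝ -
      LinearMap.snd ℝ E ℝ) p ≤ 0}) ∩
      ({p | (-LinearMap.snd ℝ E ℝ) p ≤ 0} ∩ {p | LinearMap.snd ℝ E ℝ p ≤ 1}) with hT
  have hmem : ∀ p : E × ℝ, p ∈ T ↔
      (p.1 ∈ K ∧ ∀ f ∈ G, f p.1 ≤ p.2) ∧ 0 ≤ p.2 ∧ p.2 ≤ 1 := by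
    intro p
    simp [hT]
  have hTp : IsPolyhedral T :=
    ((hK.preimage _).inter (IsPolyhedral.iInter fun _ => isPolyhedral_halfSpace _ _)).inter
      ((isPolyhedral_halfSpace _ _).inter (isPolyhedral_halfSpace _ _))
  have hTc : IsCompact T := (hc.prod (isCompact_Icc (a := (0 : ℝ)) (b := 1))).of_isClosed_subset
    hTp.isClosed fun p hp => ⟨((hmem p).1 hp).1.1, ((hmem p).1 hp).2⟩
  -- At height 0 the point is itself feasible; at positive height the fixed feasible `x₀` serves,
  -- with a constant that may blow up near height 0. Only its values at the finitely many vertices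
  -- are used.
  have hvert : ∀ p ∈ T, ∃ c : ℝ, ∃ y ∈ K, (∀ f ∈ G, f y ≤ 0) ∧ ‖p.1 - y‖ ≤ c * p.2 := by
    intro p hp
    obtain ⟨⟨h1, h2⟩, h3, -⟩ := (hmem p).1 hp
    rcases h3.eq_or_lt with h0 | hpos
    · exact ⟨0, p.1, h1, fun f hf => (h2 f hf).trans h0.ge, by simp⟩
    · exact ⟨‖p.1 - x₀‖ / p.2, x₀, hx₀, hx₀G, by rw [div_mul_cancel₀ _ hpos.ne']⟩
  choose! c hcv using hvert
  obtain ⟨B, hB⟩ := (hTp.finite_extremePoints.image c).bddAbove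
  refine ⟨max B 1, by positivity, fun x hx t ht0 ht1 hxt => ?_⟩
  set N : Set (E × ℝ) := {p | ∃ y ∈ K, (∀ f ∈ G, f y ≤ 0) ∧ ‖p.1 - y‖ ≤ max B 1 * p.2} with hN
  -- Combine the nearby feasible points with the same weights; the norm is convex and the bound
  -- linear in the height.
  have hNconv : Convex ℝ N := by
    rintro p ⟨y, hy, hyG, hpy⟩ q ⟨z, hz, hzG, hqz⟩ a b ha hb hab
    refine ⟨a • y + b • z, hK.convex hy hz ha hb hab, fun f hf => ?_, ?_⟩
    · have h1 := mul_nonpos_of_nonneg_of_nonpos ha (hyG f hf)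
      have h2 := mul_nonpos_of_nonneg_of_nonpos hb (hzG f hf)
      simpa using add_nonpos h1 h2
    · calc ‖(a • p + b • q).1 - (a • y + b • z)‖ = ‖a • (p.1 - y) + b • (q.1 - z)‖ := by
            congr 1
            simp only [Prod.fst_add, Prod.smul_fst, smul_sub]
            abel
        _ ≤ a * ‖p.1 - y‖ + b * ‖q.1 - z‖ := by
            refine (norm_add_le _ _).trans_eq ?_
            rw [norm_smul, norm_smul, Real.norm_of_nonneg ha, Real.norm_of_nonneg hb]
        _ ≤ a * (max B 1 * p.2) + b * (max B 1 * q.2) := by gcongr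
        _ = max B 1 * (a • p + b • q).2 := by
            simp only [Prod.snd_add, Prod.smul_snd, smul_eq_mul]
            ring
  have hTN : T ⊆ N := by
    rw [← hTp.convexHull_extremePoints hTc]
    refine convexHull_min (fun p hp => ?_) hNconv
    obtain ⟨y, hy, hyG, hpy⟩ := hcv p hp.1
    have h0 : 0 ≤ p.2 := ((hmem p).1 hp.1).2.1
    refine ⟨y, hy, hyG, hpy.trans ?_⟩
    gcongr
    exact (hB ⟨p, hp, rfl⟩).trans (le_max_left _ _)
  exact hTN ((hmem (x, t)).2 ⟨⟨hx, hxt⟩, ht0, ht1⟩)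

theorem isPolyhedral_stdSimplex (ι : Type*) [Fintype ι] : IsPolyhedral (stdSimplex ℝ ι) := by
  have h := (IsPolyhedral.iInter fun i : ι =>
    isPolyhedral_halfSpace (-LinearMap.proj (R := ℝ) (φ := fun _ : ι => ℝ) i) 0).inter
      (isPolyhedral_hyperplane (∑ i : ι, LinearMap.proj (R := ℝ) (φ := fun _ : ι => ℝ) i) 1)
  convert h using 1
  ext x
  simp [stdSimplex]

end Polyhedral

/-! ### Distance between reward sets and the gap -/

theorem oneSidedHausdorffDist_nonneg {ι : Type*} [Fintype ι] (X Y : Set (ι → ℝ)) :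
    0 ≤ oneSidedHausdorffDist X Y :=
  Real.iSup_nonneg fun _ => Real.iInf_nonneg fun _ => norm_nonneg _

theorem oneSidedHausdorffDist_le {ι : Type*} [Fintype ι] {X Y : Set (ι → ℝ)} {c : ℝ}
    (hc : 0 ≤ c) (h : ∀ x ∈ X, ∃ y ∈ Y, ‖x - y‖ ≤ c) : oneSidedHausdorffDist X Y ≤ c := by
  -- `hc` covers empty `X`, where the real supremum defaults to 0.
  refine Real.iSup_le (fun x => ?_) hc
  obtain ⟨y, hy, hxy⟩ := h x x.2
  have hb : BddBelow (Set.range fun y : Y => ‖(x : ι → ℝ) - (y : ι → ℝ)‖) :=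
    ⟨0, by rintro _ ⟨y, rfl⟩; exact norm_nonneg _⟩
  exact (ciInf_le hb ⟨y, hy⟩).trans hxy

namespace RewardFreeMDP

variable {S A : Type*} [Fintype S] [Fintype A]

theorem isPolyhedral_occupancySet (M : RewardFreeMDP S A) : IsPolyhedral M.occupancySet := by
  let π := fun z : S × A => LinearMap.proj (R := ℝ) (φ := fun _ : S × A => ℝ) z
  have h := (IsPolyhedral.iInter fun z => isPolyhedral_halfSpace (-π z) 0).inter
    (IsPolyhedral.iInter fun s => isPolyhedral_hyperplane
      (∑ a, π (s, a) - M.γ • ∑ z : S × A, M.P z.1 z.2 s • π z) ((1 - M.γ) * M.μ₀ s))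
  convert h using 1
  ext d
  simp [occupancySet, flow, funext_iff, Pi.le_def, π]

theorem isCompact_occupancySet (M : RewardFreeMDP S A) : IsCompact M.occupancySet :=
  (isCompact_stdSimplex ℝ (S × A)).of_isClosed_subset M.isPolyhedral_occupancySet.isClosed
    M.occupancySet_subset_stdSimplex

theorem subopt_nonneg (M : RewardFreeMDP S A) {r d : S × A → ℝ}
    (hr : r ∈ stdSimplex ℝ (S × A)) (hd : d ∈ M.occupancySet) : 0 ≤ M.subopt r d := by
  refine le_trans ?_ (le_ciSup (M.bddAbove_subopt (d := d) hr) ⟨d, hd⟩)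
  simp

theorem subopt_le_one (M : RewardFreeMDP S A) {r d : S × A → ℝ}
    (hr : r ∈ stdSimplex ℝ (S × A)) (hd : d ∈ M.occupancySet) : M.subopt r d ≤ 1 := by
  refine Real.iSup_le (fun d' => ?_) zero_le_one
  have h1 := dotProduct_le_one hr (M.occupancySet_subset_stdSimplex d'.2)
  have h2 := dotProduct_nonneg' hr (M.occupancySet_subset_stdSimplex hd)
  rw [dotProduct_sub]
  linarith

/-- The suboptimality of `d` is controlled by the extreme points of the occupancy polytope. -/
theorem subopt_le_iff (M : RewardFreeMDP S A) {r d : S × A → ℝ} {t : ℝ}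
    (hr : r ∈ stdSimplex ℝ (S × A)) (ht : 0 ≤ t) :
    M.subopt r d ≤ t ↔ ∀ v ∈ M.occupancySet.extremePoints ℝ, r ⬝ᵥ (v - d) ≤ t := by
  refine ⟨fun h v hv => (le_ciSup (M.bddAbove_subopt (d := d) hr) ⟨v, hv.1⟩).trans h,
    fun h => Real.iSup_le (fun d' => ?_) ht⟩
  -- A half-space containing the vertices contains their hull.
  have hsub : M.occupancySet ⊆ {v | r ⬝ᵥ v ≤ t + r ⬝ᵥ d} := by
    rw [← M.isPolyhedral_occupancySet.convexHull_extremePoints M.isCompact_occupancySet]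
    refine convexHull_min (fun v hv => ?_) (convex_halfSpace_le
      ⟨fun x y => dotProduct_add r x y, fun c x => dotProduct_smul c r x⟩ _)
    have := h v hv
    rw [dotProduct_sub] at this
    exact sub_le_iff_le_add.1 this
  rw [dotProduct_sub]
  exact sub_le_iff_le_add.2 (hsub d'.2)

/-- The error bound on the simplex, with violation level `subopt r d`, which lies in `[0, 1]`. The
uniform reward supplies the required feasible point. -/
theorem exists_norm_sub_le_subopt (M : RewardFreeMDP S A) {d : S × A → ℝ}
    (hd : d ∈ M.occupancySet) :
    ∃ C : ℝ, 0 < C ∧ ∀ r ∈ stdSimplex ℝ (S × A),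
      ∃ r' ∈ M.rewardSet d, ‖r - r'‖ ≤ C * M.subopt r d := by
  let φ : (S × A → ℝ) → (S × A → ℝ) →ₗ[ℝ] ℝ := fun v => (dotProductBilin ℝ ℝ).flip (v - d)
  have hφ : ∀ v r, φ v r = r ⬝ᵥ (v - d) := fun v r => rfl
  have hiff : ∀ r ∈ stdSimplex ℝ (S × A), ∀ t : ℝ, 0 ≤ t →
      (M.subopt r d ≤ t ↔ ∀ f ∈ φ '' M.occupancySet.extremePoints ℝ, f r ≤ t) := by
    intro r hr t ht
    simp only [Set.forall_mem_image, hφ, M.subopt_le_iff hr ht]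
  obtain ⟨r₀, hr₀⟩ := M.exists_mem_rewardSet ⟨d, hd⟩
  have hr₀' := (M.mem_rewardSet_iff hd).1 (hr₀ d hd)
  obtain ⟨C, hC, h⟩ := (isPolyhedral_stdSimplex (S × A)).exists_error_bound
    (isCompact_stdSimplex ℝ (S × A))
    (M.isPolyhedral_occupancySet.finite_extremePoints.image φ)
    ⟨r₀, hr₀'.1, (hiff r₀ hr₀'.1 0 le_rfl).1 hr₀'.2⟩
  refine ⟨C, hC, fun r hr => ?_⟩
  obtain ⟨r', hr', h0, hle⟩ := h r hr _ (M.subopt_nonneg hr hd) (M.subopt_le_one hr hd)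
    ((hiff r hr _ (M.subopt_nonneg hr hd)).1 le_rfl)
  exact ⟨r', (M.mem_rewardSet_iff hd).2 ⟨hr', (hiff r' hr' 0 le_rfl).2 h0⟩, hle⟩

theorem gap_nonneg (M : RewardFreeMDP S A) {R : Set (S × A → ℝ)} {d : S × A → ℝ}
    (hR : R ⊆ stdSimplex ℝ (S × A)) (hd : d ∈ M.occupancySet) : 0 ≤ M.gap R d :=
  Real.iSup_nonneg fun r => M.subopt_nonneg (hR r.2) hd

theorem exists_oneSidedHausdorffDist_le_gap (M : RewardFreeMDP S A) {d : S × A → ℝ}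
    (hd : d ∈ M.occupancySet) :
    ∃ C : ℝ, 0 < C ∧ ∀ R ⊆ stdSimplex ℝ (S × A),
      oneSidedHausdorffDist R (M.rewardSet d) ≤ C * M.gap R d := by
  obtain ⟨C, hC, h⟩ := M.exists_norm_sub_le_subopt hd
  refine ⟨C, hC, fun R hR => oneSidedHausdorffDist_le
    (mul_nonneg hC.le (M.gap_nonneg hR hd)) fun r hr => ?_⟩
  obtain ⟨r', hr', hle⟩ := h r (hR hr)
  refine ⟨r', hr', hle.trans ?_⟩
  gcongr
  exact le_ciSup (M.bddAbove_gap hR hd) ⟨r, hr⟩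

theorem feasibleRewardSet_subset_stdSimplex (M : RewardFreeMDP S A) (D : M.Dataset) :
    M.feasibleRewardSet D ⊆ stdSimplex ℝ (S × A) := fun _ h => h.1

end RewardFreeMDP

theorem mainTheorem7 {S A : Type*} [Fintype S] [Fintype A] (M : RewardFreeMDP S A) :
    (∃ C : ℝ, 0 < C ∧ ∀ dstar ∈ M.occupancySet.extremePoints ℝ, ∀ D : M.Dataset,
      oneSidedHausdorffDist (M.feasibleRewardSet D) (M.rewardSet dstar) ≤
        C * M.gap (M.feasibleRewardSet D) dstar) ∧
    (∀ dstar ∈ M.occupancySet,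
      (∃ C : ℝ, 0 < C ∧ ∀ D : M.Dataset,
        oneSidedHausdorffDist (M.feasibleRewardSet D) (M.rewardSet dstar) ≤
          C * M.gap (M.feasibleRewardSet D) dstar) ∧
      (∀ l : Filter M.Dataset,
        Tendsto (fun D => M.gap (M.feasibleRewardSet D) dstar) l (𝓝 0) →
        Tendsto (fun D => oneSidedHausdorffDist (M.feasibleRewardSet D) (M.rewardSet dstar))
          l (𝓝 0))) := by
  have hsub := M.feasibleRewardSet_subset_stdSimplex
  have hmain : ∀ d ∈ M.occupancySet, ∃ C : ℝ, 0 < C ∧ ∀ R ⊆ stdSimplex ℝ (S × A),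
      oneSidedHausdorffDist R (M.rewardSet d) ≤ C * M.gap R d :=
    fun _ hd => M.exists_oneSidedHausdorffDist_le_gap hd
  choose! c hc0 hc using hmain
  refine ⟨?_, fun d hd => ⟨⟨c d, hc0 d hd, fun D => hc d hd _ (hsub D)⟩, fun l hl => ?_⟩⟩
  -- There are finitely many vertices, so their constants are bounded; `max B 1` keeps the common
  -- one positive.
  · obtain ⟨B, hB⟩ := (M.isPolyhedral_occupancySet.finite_extremePoints.image c).bddAbove
    refine ⟨max B 1, by positivity, fun d hd D => (hc d hd.1 _ (hsub D)).trans ?_⟩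
    have := M.gap_nonneg (hsub D) hd.1
    gcongr
    exact (hB ⟨d, hd, rfl⟩).trans (le_max_left _ _)
  · refine squeeze_zero (fun D => oneSidedHausdorffDist_nonneg _ _)
      (fun D => hc d hd _ (hsub D)) ?_
    simpa using hl.const_mul (c d)
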